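/- Let $F$ be a field, and let $A$ and $B$ be $F$-central division algebras, that is, division rings which are finite-dimensional $F$-algebras with center exactly $F$. Suppose that the indices $\operatorname{ind}(A)=\sqrt{[A:F]}$ and $\operatorname{ind}(B)=\sqrt{[B:F]}$ are relatively prime. For an $F$-algebra $R$ with unit group $R^*$ and commutator subgroup $R'=[R^*,R^*]$, put $\operatorname{CK}(R)=R^*/F^*R'$. Then there is an isomorphism of groups $$\operatorname{CK}(A\otimes_F B)\;\cong\;\operatorname{CK}(A)\times\operatorname{CK}(B).$$ -/

import Mathlib

open scoped TensorProduct

universe u v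

/-- The degree `√[A : F]` of a central simple `F`-algebra `A`
(the dimension of such an algebra is a perfect square). -/
noncomputable def algDegree (F : Type u) (A : Type v) [Field F] [Ring A] [Algebra F A] : ℕ :=
  Nat.sqrt (Module.finrank F A)

/-- The (Schur) index of a central simple `F`-algebra `A`: the degree of the division algebra `D`,
unique up to isomorphism, such that `A` is isomorphic to a matrix algebra `M_m(D)`, `m ≥ 1`.
The infimum is over a set that has exactly one element when `A` is central simple. -/
noncomputable def schurIndex (F : Type u) (A : Type v) [Field F] [Ring A] [Algebra F A] : ℕ :=
  sInf {n : ℕ | ∃ (m : ℕ) (D : Type v) (_ : DivisionRing D) (_ : Algebra F D),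
    0 < m ∧ Nonempty (A ≃ₐ[F] Matrix (Fin m) (Fin m) D) ∧ algDegree F D = n}

/-- The subgroup `F^* A'` of the unit group `A^*` of an `F`-algebra `A`, where `A'` denotes the
commutator subgroup of `A^*`. -/
def ckSubgroup (F : Type u) (A : Type v) [Field F] [Ring A] [Algebra F A] : Subgroup Aˣ :=
  (Units.map (algebraMap F A : F →* A)).range ⊔ commutator Aˣ

instance ckSubgroup_normal (F : Type u) (A : Type v) [Field F] [Ring A] [Algebra F A] :
    (ckSubgroup F A).Normal := by
  refine ⟨fun n hn g => ?_⟩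
  have h : g * n * g⁻¹ * n⁻¹ ∈ commutator Aˣ :=
    Subgroup.commutator_mem_commutator (Subgroup.mem_top g) (Subgroup.mem_top n)
  have h2 := (ckSubgroup F A).mul_mem ((le_sup_right : commutator Aˣ ≤ ckSubgroup F A) h) hn
  simpa using h2

/-- The group `CK(A) = A^* / F^* A'`. -/
abbrev CK (F : Type u) (A : Type v) [Field F] [Ring A] [Algebra F A] : Type v :=
  Aˣ ⧸ ckSubgroup F A

/-! ### Gaussian elimination over a division ring -/

section RowDeterminant

open Matrix

variable {D : Type*} [DivisionRing D] {n : Type*} [Fintype n] [DecidableEq n]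

/-! Put C = A ⊗ B and n = [B : F]. The regular representation of B extends to ρ : C → M_n(A).
Following it by the Dieudonné determinant gives a transfer Φ : CK(C) → CK(A) (`exists_ck_transfer`);
determinants are needed only modulo signs, since -1 lies in F^*. On the image of A, ρ is scalar, so
Φ is the n-th power; on the image of B, ρ has entries in F, so Φ is trivial. Going back from CK(A)
to CK(C) after Φ is again the n-th power, because over C the matrix ρ(c) becomes conjugate to the
scalar matrix c (`scalar_mul_mulTable`). The case A = F shows that n kills CK(B)
(`ck_pow_finrank_eq_one`). If [A : F] and [B : F] are coprime, the transfers to both factors and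
Bézout make CK(A) × CK(B) → CK(C) bijective. Dimensions of central division algebras are squares, so
coprime indices give coprime dimensions; these also make C a division algebra, over which the
determinant is available. -/

theorem Matrix.vecMul_updateRow_eq (M : Matrix n n D) (i : n) (v w : n → D) :
    w ᵥ* M.updateRow i v = Function.update w i 0 ᵥ* M + w i • v := by
  ext j
  simp only [vecMul, dotProduct, Pi.add_apply, Pi.smul_apply, smul_eq_mul]
  rw [Fintype.sum_eq_add_sum_compl i, Fintype.sum_eq_add_sum_compl i]
  simp only [updateRow_self, Function.update_self, zero_mul, zero_add]
  rw [add_comm]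
  congr 1
  refine Finset.sum_congr rfl fun k hk => ?_
  have hk : k ≠ i := by simpa using hk
  rw [updateRow_ne hk, Function.update_of_ne hk]

/-- A row operation is left multiplication by an elementary matrix, so it can be moved onto the row
vector. -/
theorem Matrix.vecMul_updateRow_add_smul (M : Matrix n n D) (i j : n) (c : D)
    (w : n → D) :
    w ᵥ* M.updateRow i (M i + c • M j) = Function.update w j (w j + w i * c) ᵥ* M := by
  rw [vecMul_updateRow_eq]
  ext l
  simp only [vecMul, dotProduct, Pi.add_apply, Pi.smul_apply, smul_eq_mul]
  have h1 : ∀ k, Function.update w i 0 k * M k l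
      = w k * M k l - if k = i then w i * M i l else 0 := by
    intro k; by_cases hk : k = i <;> simp [hk]
  have h2 : ∀ k, Function.update w j (w j + w i * c) k * M k l
      = w k * M k l + if k = j then w i * c * M j l else 0 := by
    intro k; by_cases hk : k = j <;> simp [hk, add_mul]
  simp only [h1, h2, Finset.sum_sub_distrib, Finset.sum_add_distrib, Finset.sum_ite_eq',
    Finset.mem_univ, if_true, mul_add, mul_assoc]
  abel

theorem Matrix.vecMul_updateRow_smul (M : Matrix n n D) (i : n) (c : D) (w : n → D) :
    w ᵥ* M.updateRow i (c • M i) = Function.update w i (w i * c) ᵥ* M := by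
  rw [vecMul_updateRow_eq]
  ext l
  simp only [vecMul, dotProduct, Pi.add_apply, Pi.smul_apply, smul_eq_mul]
  have h1 : ∀ k, Function.update w i (w i * c) k * M k l
      = Function.update w i 0 k * M k l + if k = i then w i * c * M i l else 0 := by
    intro k; by_cases hk : k = i <;> simp [hk]
  simp only [h1, Finset.sum_add_distrib, Finset.sum_ite_eq', Finset.mem_univ, if_true, mul_assoc]

omit [DecidableEq n] in
theorem Matrix.exists_vecMul_eq_of_vecMul_injective {M : Matrix n n D}
    (h : ∀ w : n → D, w ᵥ* M = 0 → w = 0) (v : n → D) : ∃ w, w ᵥ* M = v := by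
  have hinj : Function.Injective (Matrix.vecMulLinear M) :=
    (injective_iff_map_eq_zero _).2 fun w hw => h w hw
  exact LinearMap.injective_iff_surjective.1 hinj v

/-- Injectivity gives surjectivity by dimension, hence a left inverse N row by row; then (MN - 1)M =
0 and injectivity make N a right inverse. -/
theorem Matrix.isUnit_iff_forall_vecMul_eq_zero {M : Matrix n n D} :
    IsUnit M ↔ ∀ w : n → D, w ᵥ* M = 0 → w = 0 := by
  constructor
  · rintro ⟨u, rfl⟩ w hw
    have := congrArg (· ᵥ* (↑u⁻¹ : Matrix n n D)) hw
    simpa using this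
  · intro h
    choose f hf using exists_vecMul_eq_of_vecMul_injective h
    have h1 : (of fun i => f (Pi.single i 1)) * M = 1 := by
      ext i j
      have := congrFun (hf (Pi.single i 1)) j
      rw [one_apply]
      simpa [vecMul, dotProduct, mul_apply, Pi.single_apply, eq_comm] using this
    have h2 : M * (of fun i => f (Pi.single i 1)) = 1 := by
      rw [← sub_eq_zero]
      have h3 : (M * (of fun i => f (Pi.single i 1)) - 1) * M = 0 := by
        rw [sub_mul, mul_assoc, h1, mul_one, one_mul, sub_self]
      ext i j
      have := h (fun j => (M * (of fun i => f (Pi.single i 1)) - 1) i j) (by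
        ext l
        exact congrFun (congrFun h3 i) l)
      exact congrFun this j
    exact ⟨⟨M, _, h2, h1⟩, rfl⟩

theorem Matrix.isUnit_updateRow_add_smul {M : Matrix n n D} (hM : IsUnit M) {i j : n}
    (hij : i ≠ j) (c : D) : IsUnit (M.updateRow i (M i + c • M j)) := by
  rw [isUnit_iff_forall_vecMul_eq_zero] at hM ⊢
  intro w hw
  rw [vecMul_updateRow_add_smul M i j] at hw
  have h := hM _ hw
  have h0 : ∀ k, k ≠ j → w k = 0 := fun k hk => by
    simpa [hk] using congrFun h k
  ext k
  by_cases hk : k = j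
  · subst hk
    simpa [h0 i hij] using congrFun h k
  · exact h0 k hk

theorem Matrix.isUnit_updateRow_smul {M : Matrix n n D} (hM : IsUnit M) (i : n) {c : D}
    (hc : c ≠ 0) : IsUnit (M.updateRow i (c • M i)) := by
  rw [isUnit_iff_forall_vecMul_eq_zero] at hM ⊢
  intro w hw
  rw [vecMul_updateRow_smul] at hw
  have h := hM _ hw
  ext k
  have := congrFun h k
  by_cases hk : k = i
  · subst hk
    simpa [hc] using this
  · simpa [hk] using this

omit [Fintype n] in
theorem Matrix.updateRow_add_smul_cancel (M : Matrix n n D) {i j : n} (hij : i ≠ j) (c : D) :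
    (M.updateRow i (M i + c • M j)).updateRow i
      ((M.updateRow i (M i + c • M j)) i + (-c) • (M.updateRow i (M i + c • M j)) j) = M := by
  ext k l
  by_cases hk : k = i
  · subst hk
    simp [updateRow_ne hij.symm]
  · simp [updateRow_ne hk]

omit [Fintype n] in
theorem Matrix.updateRow_smul_cancel (M : Matrix n n D) (i : n) {c : D} (hc : c ≠ 0) :
    (M.updateRow i (c • M i)).updateRow i (c⁻¹ • (M.updateRow i (c • M i)) i) = M := by
  ext k l
  by_cases hk : k = i
  · subst hk
    simp [hc]
  · simp [updateRow_ne hk]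

/-- Gauss elimination as an induction principle: every invertible matrix over a division ring
is reached from the identity by elementary row operations. -/
theorem Matrix.isUnit_rowOp_induction {P : Matrix n n D → Prop} (one : P 1)
    (add : ∀ M : Matrix n n D, IsUnit M → ∀ i j, i ≠ j → ∀ c : D, P M →
      P (M.updateRow i (M i + c • M j)))
    (smul : ∀ M : Matrix n n D, IsUnit M → ∀ i, ∀ c : D, c ≠ 0 → P M →
      P (M.updateRow i (c • M i)))
    {M : Matrix n n D} (hM : IsUnit M) : P M := by
  have add' : ∀ M : Matrix n n D, IsUnit M → ∀ i j, i ≠ j → ∀ c : D,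
      P (M.updateRow i (M i + c • M j)) → P M := fun M hM i j hij c h => by
    have := add _ (isUnit_updateRow_add_smul hM hij c) i j hij (-c) h
    rwa [updateRow_add_smul_cancel M hij] at this
  have smul' : ∀ M : Matrix n n D, IsUnit M → ∀ i, ∀ c : D, c ≠ 0 →
      P (M.updateRow i (c • M i)) → P M := fun M hM i c hc h => by
    have := smul _ (isUnit_updateRow_smul hM i hc) i c⁻¹ (inv_ne_zero hc) h
    rwa [updateRow_smul_cancel M i hc] at this
  suffices H : ∀ s : Finset n, ∀ M : Matrix n n D, IsUnit M →
      (∀ j ∉ s, ∀ i, M i j = (1 : Matrix n n D) i j) → P M from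
    H Finset.univ M hM (by simp)
  intro s
  induction s using Finset.induction_on with
  | empty =>
    intro M _ h
    have : M = 1 := by ext i j; exact h j (by simp) i
    rwa [this]
  | insert k s hk ih =>
    -- clearing column `k` once its diagonal entry is `1`
    have clear : ∀ t : Finset n, ∀ M : Matrix n n D, IsUnit M →
        (∀ j ∉ insert k s, ∀ i, M i j = (1 : Matrix n n D) i j) → M k k = 1 →
        (∀ i ∉ t, i ≠ k → M i k = 0) → k ∉ t → P M := by
      intro t
      induction t using Finset.induction_on with
      | empty =>
        intro M hM h1 h2 h3 _
        refine ih M hM fun j hj i => ?_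
        by_cases hjk : j = k
        · subst hjk
          by_cases hi : i = j
          · subst hi; simpa using h2
          · rw [one_apply_ne hi]; exact h3 i (by simp) hi
        · exact h1 j (by simp [hjk, hj]) i
      | insert r t hr iht =>
        intro M hM h1 h2 h3 hkt
        have hrk : r ≠ k := fun h => hkt (by simp [h])
        refine add' M hM r k hrk (-M r k) (iht _ (isUnit_updateRow_add_smul hM hrk _) ?_ ?_ ?_ ?_)
        · intro j hj i
          by_cases hi : i = r
          · subst hi
            have hjk : k ≠ j := fun h => hj (by simp [h])
            simp [h1 j hj, one_apply_ne hjk]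
          · rw [updateRow_ne hi]; exact h1 j hj i
        · rw [updateRow_ne hrk.symm]; exact h2
        · intro i hi hik
          by_cases hir : i = r
          · subst hir; simp [h2]
          · rw [updateRow_ne hir]; exact h3 i (by simp [hir, hi]) hik
        · exact fun h => hkt (by simp [h])
    have scale : ∀ M : Matrix n n D, IsUnit M →
        (∀ j ∉ insert k s, ∀ i, M i j = (1 : Matrix n n D) i j) → M k k ≠ 0 → P M := by
      intro M hM h1 h2
      refine smul' M hM k (M k k)⁻¹ (inv_ne_zero h2)
        (clear (Finset.univ.erase k) _ (isUnit_updateRow_smul hM k (inv_ne_zero h2)) ?_ ?_ ?_ ?_)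
      · intro j hj i
        by_cases hi : i = k
        · subst hi
          have hjk : i ≠ j := fun h => hj (by simp [h])
          simp [h1 j hj, one_apply_ne hjk]
        · rw [updateRow_ne hi]; exact h1 j hj i
      · simp [h2]
      · intro i hi hik; simp [hik] at hi
      · simp
    intro M hM h1
    by_cases h2 : M k k = 0
    -- Search for a pivot: with wM = e_k, the columns already standard force w to vanish outside
    -- `insert k s`, so column k must be nonzero in some row of `s`.
    · obtain ⟨w, hw⟩ := exists_vecMul_eq_of_vecMul_injective
        (isUnit_iff_forall_vecMul_eq_zero.1 hM) (Pi.single k 1)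
      have hw0 : ∀ j ∉ insert k s, w j = 0 := by
        intro j hj
        have := congrFun hw j
        have hjk : j ≠ k := fun h => hj (by simp [h])
        simpa [vecMul, dotProduct, h1 j hj, one_apply, hjk] using this
      obtain ⟨r, hr⟩ : ∃ r ∈ s, M r k ≠ 0 := by
        by_contra! hcon
        have := congrFun hw k
        rw [vecMul, dotProduct, Finset.sum_eq_zero] at this
        · simp at this
        · intro i _
          by_cases hi : i ∈ insert k s
          · rcases Finset.mem_insert.1 hi with rfl | hi
            · rw [h2, mul_zero]
            · rw [hcon i hi, mul_zero]
          · rw [hw0 i hi, zero_mul]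
      have hkr : k ≠ r := fun h => hk (h ▸ hr.1)
      refine add' M hM k r hkr 1 (scale _ (isUnit_updateRow_add_smul hM hkr _) ?_ ?_)
      · intro j hj i
        by_cases hi : i = k
        · subst hi
          have hjr : r ≠ j := fun h => hj (by simp [← h, hr.1])
          simp [h1 j hj, one_apply_ne hjr]
        · rw [updateRow_ne hi]; exact h1 j hj i
      · simpa [h2] using hr.2
    · exact scale M hM h1 h2

end RowDeterminant

/-! ### The Dieudonné determinant modulo signs -/

section RowDeterminant

open Matrix

variable {D : Type*} [DivisionRing D] {G : Type*} [CommGroupWithZero G]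
  {n : Type*} [Fintype n] [DecidableEq n]

/-- A determinant on the invertible matrices over a division ring, with values in a commutative
group with zero, characterized by its behaviour under elementary row operations. -/
structure IsRowDet (χ : D →*₀ G) (Δ : Matrix n n D → G) : Prop where
  map_one : Δ 1 = 1
  map_add : ∀ M : Matrix n n D, IsUnit M → ∀ i j, i ≠ j → ∀ c : D,
    Δ (M.updateRow i (M i + c • M j)) = Δ M
  map_smul : ∀ M : Matrix n n D, IsUnit M → ∀ i, ∀ c : D, c ≠ 0 →
    Δ (M.updateRow i (c • M i)) = χ c * Δ M

namespace IsRowDet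

variable {χ : D →*₀ G} {Δ : Matrix n n D → G}

theorem eq_of_isUnit {Δ' : Matrix n n D → G} (h : IsRowDet χ Δ) (h' : IsRowDet χ Δ')
    {M : Matrix n n D} (hM : IsUnit M) : Δ M = Δ' M := by
  refine isUnit_rowOp_induction (P := fun M => Δ M = Δ' M) ?_ ?_ ?_ hM
  · rw [h.map_one, h'.map_one]
  · intro M hM i j hij c e
    rw [h.map_add M hM i j hij, h'.map_add M hM i j hij, e]
  · intro M hM i c hc e
    rw [h.map_smul M hM i c hc, h'.map_smul M hM i c hc, e]

theorem ne_zero (h : IsRowDet χ Δ) {M : Matrix n n D} (hM : IsUnit M) : Δ M ≠ 0 := by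
  refine isUnit_rowOp_induction (P := fun M => Δ M ≠ 0) ?_ ?_ ?_ hM
  · rw [h.map_one]; exact one_ne_zero
  · intro M hM i j hij c e
    rwa [h.map_add M hM i j hij]
  · intro M hM i c hc e
    rw [h.map_smul M hM i c hc]
    exact mul_ne_zero (by simpa using hc) e

/-- Row operations on M commute with right multiplication by N, so induction on M suffices. -/
theorem map_mul (h : IsRowDet χ Δ) {M N : Matrix n n D} (hM : IsUnit M) (hN : IsUnit N) :
    Δ (M * N) = Δ M * Δ N := by
  have key : ∀ (M : Matrix n n D) i v, M.updateRow i v * N = (M * N).updateRow i (v ᵥ* N) := by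
    intro M i v
    ext k l
    by_cases hk : k = i
    · subst hk; simp [Matrix.mul_apply, vecMul, dotProduct]
    · simp [Matrix.mul_apply, updateRow_ne hk]
  have row : ∀ (M : Matrix n n D) i, M i ᵥ* N = (M * N) i := fun M i => rfl
  refine isUnit_rowOp_induction (P := fun M => Δ (M * N) = Δ M * Δ N) ?_ ?_ ?_ hM
  · rw [h.map_one, one_mul, one_mul]
  · intro M hM i j hij c e
    rw [h.map_add M hM i j hij, key, add_vecMul, smul_vecMul, row, row,
      h.map_add _ (hM.mul hN) i j hij, e]
  · intro M hM i c hc e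
    rw [h.map_smul M hM i c hc, key, smul_vecMul, row, h.map_smul _ (hM.mul hN) i c hc, e,
      mul_assoc]

theorem map_diagonal (h : IsRowDet χ Δ) (d : n → D) (hd : ∀ i, d i ≠ 0) :
    Δ (diagonal d) = ∏ i, χ (d i) := by
  have key : ∀ s : Finset n, IsUnit (diagonal (s.piecewise d 1)) ∧
      Δ (diagonal (s.piecewise d 1)) = ∏ i ∈ s, χ (d i) := by
    intro s
    induction s using Finset.induction_on with
    | empty => simpa using h.map_one
    | insert k s hk ih =>
      have e : diagonal ((insert k s).piecewise d 1) = (diagonal (s.piecewise d 1)).updateRow k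
          (d k • (diagonal (s.piecewise d 1)) k) := by
        ext i j
        by_cases hi : i = k
        · subst hi
          by_cases hj : i = j
          · subst hj; simp [hk]
          · simp [hj]
        · rw [updateRow_ne hi]
          by_cases hj : i = j
          · subst hj; simp [Finset.piecewise, hi]
          · simp [hj]
      rw [e, h.map_smul _ ih.1 k _ (hd k), Finset.prod_insert hk, ih.2]
      exact ⟨isUnit_updateRow_smul ih.1 k (hd k), rfl⟩
  simpa using (key Finset.univ).2

theorem comp_map {C : Type*} [DivisionRing C] (f : C →+* D) (h : IsRowDet χ Δ) :
    IsRowDet (χ.comp (RingHom.toMonoidWithZeroHom f)) fun M : Matrix n n C => Δ (M.map f) := by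
  have hu : ∀ M : Matrix n n C, IsUnit M → IsUnit (M.map f) := fun M hM =>
    hM.map (f.mapMatrix (m := n))
  refine ⟨?_, ?_, ?_⟩
  · simp [h.map_one]
  · intro M hM i j hij c
    have e : (M.updateRow i (M i + c • M j)).map f
        = (M.map f).updateRow i ((M.map f) i + f c • (M.map f) j) := by
      ext k l; by_cases hk : k = i
      · subst hk; simp
      · simp [updateRow_ne hk]
    simp only [e, h.map_add _ (hu M hM) i j hij]
  · intro M hM i c hc
    have e : (M.updateRow i (c • M i)).map f = (M.map f).updateRow i (f c • (M.map f) i) := by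
      ext k l; by_cases hk : k = i
      · subst hk; simp
      · simp [updateRow_ne hk]
    simp only [e, h.map_smul _ (hu M hM) i _ ((map_ne_zero f).2 hc)]
    rfl

theorem map_comp {H : Type*} [CommGroupWithZero H] (g : G →*₀ H) (h : IsRowDet χ Δ) :
    IsRowDet (g.comp χ) fun M => g (Δ M) :=
  ⟨by simp [h.map_one], fun M hM i j hij c => by simp only [h.map_add M hM i j hij],
    fun M hM i c hc => by simp [h.map_smul M hM i c hc]⟩

/-- Scale row i first, then add the multiples of the other rows one at a time. -/
theorem map_add_sum (h : IsRowDet χ Δ) {M : Matrix n n D} (hM : IsUnit M) (i : n) (c : n → D)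
    (hc : c i ≠ 0) : Δ (M.updateRow i (∑ k, c k • M k)) = χ (c i) * Δ M := by
  have key : ∀ s : Finset n, i ∉ s →
      IsUnit (M.updateRow i (c i • M i + ∑ k ∈ s, c k • M k)) ∧
      Δ (M.updateRow i (c i • M i + ∑ k ∈ s, c k • M k)) = χ (c i) * Δ M := by
    intro s
    induction s using Finset.induction_on with
    | empty =>
      intro _
      simp only [Finset.sum_empty, add_zero]
      exact ⟨isUnit_updateRow_smul hM i hc, h.map_smul M hM i _ hc⟩
    | insert r s hr ih =>
      intro hi
      have hir : i ≠ r := fun h => hi (by simp [h])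
      obtain ⟨h1, h2⟩ := ih fun h => hi (by simp [h])
      have e : M.updateRow i (c i • M i + ∑ k ∈ insert r s, c k • M k)
          = (M.updateRow i (c i • M i + ∑ k ∈ s, c k • M k)).updateRow i
            ((M.updateRow i (c i • M i + ∑ k ∈ s, c k • M k)) i
              + c r • (M.updateRow i (c i • M i + ∑ k ∈ s, c k • M k)) r) := by
        rw [updateRow_self, updateRow_ne hir.symm, updateRow_idem, Finset.sum_insert hr]
        congr 1
        abel
      rw [e]
      exact ⟨isUnit_updateRow_add_smul h1 hir _, (h.map_add _ h1 i r hir _).trans h2⟩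
  have := (key (Finset.univ.erase i) (by simp)).2
  rwa [Finset.add_sum_erase _ (fun k => c k • M k) (Finset.mem_univ i)] at this

/-- A swap is three row additions and one scaling by -1, which χ does not see. -/
theorem map_swap (h : IsRowDet χ Δ) (hχ : χ (-1) = 1) {M : Matrix n n D} (hM : IsUnit M)
    (i j : n) : Δ (M.submatrix (Equiv.swap i j) id) = Δ M := by
  by_cases hij : i = j
  · subst hij; simp
  set M₁ := M.updateRow i (M i + (1 : D) • M j) with h₁
  have u₁ : IsUnit M₁ := isUnit_updateRow_add_smul hM hij _
  set M₂ := M₁.updateRow j (M₁ j + (-1 : D) • M₁ i) with h₂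
  have u₂ : IsUnit M₂ := isUnit_updateRow_add_smul u₁ (Ne.symm hij) _
  set M₃ := M₂.updateRow i (M₂ i + (1 : D) • M₂ j) with h₃
  have u₃ : IsUnit M₃ := isUnit_updateRow_add_smul u₂ hij _
  have e : M.submatrix (Equiv.swap i j) id = M₃.updateRow j ((-1 : D) • M₃ j) := by
    ext k l
    by_cases hkj : k = j
    · subst hkj
      simp [h₃, h₂, h₁, updateRow_ne (Ne.symm hij)]
    · by_cases hki : k = i
      · subst hki
        simp [h₃, h₂, h₁, updateRow_ne hij, updateRow_ne (Ne.symm hij)]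
      · simp [h₃, h₂, h₁, updateRow_ne hki, updateRow_ne hkj,
          Equiv.swap_apply_of_ne_of_ne hki hkj]
  rw [e, h.map_smul _ u₃ _ _ (by simp), hχ, one_mul, h₃, h.map_add _ u₂ _ _ hij, h₂,
    h.map_add _ u₁ _ _ (Ne.symm hij), h₁, h.map_add _ hM _ _ hij]

theorem map_perm (h : IsRowDet χ Δ) (hχ : χ (-1) = 1) {M : Matrix n n D} (hM : IsUnit M)
    (σ : Equiv.Perm n) : Δ (M.submatrix σ id) = Δ M := by
  have hu : ∀ (M : Matrix n n D) (σ : Equiv.Perm n), IsUnit M → IsUnit (M.submatrix σ id) := by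
    intro M σ hM
    rw [isUnit_iff_forall_vecMul_eq_zero] at hM ⊢
    intro w hw
    have := hM (w ∘ σ.symm) (by
      rw [← hw]
      ext l
      simp only [vecMul, dotProduct, Function.comp_apply, submatrix_apply, id]
      exact (Equiv.sum_comp σ fun k => w (σ.symm k) * M k l).symm.trans (by simp))
    ext k
    simpa using congrFun this (σ k)
  induction σ using Equiv.Perm.swap_induction_on' generalizing M with
  | one => simp
  | mul_swap f x y hxy ih =>
    have : M.submatrix (f * Equiv.swap x y : Equiv.Perm n) id
        = (M.submatrix f id).submatrix (Equiv.swap x y) id := rfl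
    rw [this, h.map_swap hχ (hu M f hM), ih hM]

end IsRowDet

/-- Delete row `i` and the first column. -/
def Matrix.rowMinor {R : Type*} {n : ℕ} (M : Matrix (Fin (n + 1)) (Fin (n + 1)) R)
    (i : Fin (n + 1)) : Matrix (Fin n) (Fin n) R :=
  M.submatrix i.succAbove Fin.succ

/-- Here l is the first row of M⁻¹. If w kills the minor, padding w by 0 at i gives w' with w'M = c
e_0, so w' = c l; the i-th coordinate forces c = 0. -/
theorem Matrix.isUnit_rowMinor {n : ℕ} {M : Matrix (Fin (n + 1)) (Fin (n + 1)) D} (hM : IsUnit M)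
    {l : Fin (n + 1) → D} (hl : l ᵥ* M = Pi.single 0 1) {i : Fin (n + 1)} (hi : l i ≠ 0) :
    IsUnit (M.rowMinor i) := by
  rw [isUnit_iff_forall_vecMul_eq_zero] at hM ⊢
  intro w hw
  have h1 : (i.insertNth 0 w - ((i.insertNth 0 w : Fin (n + 1) → D) ᵥ* M) 0 • l : Fin (n + 1) → D)
      ᵥ* M = 0 := by
    rw [sub_vecMul, smul_vecMul, hl]
    ext j
    refine Fin.cases ?_ (fun j => ?_) j
    · simp
    · have := congrFun hw j
      simpa [vecMul, dotProduct, Fin.sum_univ_succAbove _ i, rowMinor] using this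
  have h2 := hM _ h1
  have h3 : ((i.insertNth 0 w : Fin (n + 1) → D) ᵥ* M) 0 = 0 := by
    have := congrFun h2 i
    simpa [hi] using this
  rw [h3, zero_smul, sub_zero] at h2
  ext k
  simpa using congrFun h2 (i.succAbove k)

theorem Matrix.rowMinor_updateRow_self {R : Type*} {n : ℕ}
    (M : Matrix (Fin (n + 1)) (Fin (n + 1)) R) (i : Fin (n + 1)) (v : Fin (n + 1) → R) :
    (M.updateRow i v).rowMinor i = M.rowMinor i := by
  ext k l
  simp [rowMinor]

theorem Matrix.rowMinor_updateRow_succAbove {R : Type*} {n : ℕ}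
    (M : Matrix (Fin (n + 1)) (Fin (n + 1)) R) (i : Fin (n + 1)) (r : Fin n)
    (v : Fin (n + 1) → R) :
    (M.updateRow (i.succAbove r) v).rowMinor i = (M.rowMinor i).updateRow r (v ∘ Fin.succ) := by
  ext k l
  by_cases hk : k = r
  · subst hk; simp [rowMinor]
  · rw [updateRow_ne hk]
    simp only [rowMinor, submatrix_apply]
    rw [updateRow_ne fun h => hk (Fin.succAbove_right_injective h)]

theorem Fin.exists_perm_update_succAbove {n : ℕ} {i j : Fin (n + 1)} {r : Fin n}
    (hr : j.succAbove r = i) (hij : i ≠ j) :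
    ∃ σ : Equiv.Perm (Fin n), ∀ k, Function.update j.succAbove r j k = i.succAbove (σ k) := by
  have hne : ∀ k, Function.update j.succAbove r j k ≠ i := by
    intro k
    by_cases hk : k = r
    · subst hk; simpa using hij.symm
    · rw [Function.update_of_ne hk, ← hr]
      exact fun h => hk (Fin.succAbove_right_injective h)
  choose σ hσ using fun k => Fin.exists_succAbove_eq (hne k)
  have hinj : Function.Injective σ := by
    intro a b hab
    have h : Function.update j.succAbove r j a = Function.update j.succAbove r j b := by
      rw [← hσ a, ← hσ b, hab]
    by_cases ha : a = r <;> by_cases hb : b = r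
    · rw [ha, hb]
    · subst ha
      rw [Function.update_self, Function.update_of_ne hb] at h
      exact absurd h.symm (Fin.succAbove_ne j b)
    · subst hb
      rw [Function.update_self, Function.update_of_ne ha] at h
      exact absurd h (Fin.succAbove_ne j a)
    · rw [Function.update_of_ne ha, Function.update_of_ne hb] at h
      exact Fin.succAbove_right_injective h
  exact ⟨Equiv.ofBijective σ (Finite.injective_iff_bijective.1 hinj), fun k => (hσ k).symm⟩

namespace IsRowDet

variable {χ : D →*₀ G} {m : ℕ} {Δ : Matrix (Fin m) (Fin m) D → G}

/-- Outside the first column, lM = e_0 is a linear relation among rows. Solving it for row j shows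
that minor i is, up to a permutation, minor j with one row replaced by a combination whose
coefficient at that row is -(l j)⁻¹ l i. -/
theorem rowMinor_eq (h : IsRowDet χ Δ) (hχ : χ (-1) = 1)
    {M : Matrix (Fin (m + 1)) (Fin (m + 1)) D} (hM : IsUnit M) {l : Fin (m + 1) → D}
    (hl : l ᵥ* M = Pi.single 0 1) {i j : Fin (m + 1)} (hi : l i ≠ 0) (hj : l j ≠ 0) :
    (χ (l i))⁻¹ * Δ (M.rowMinor i) = (χ (l j))⁻¹ * Δ (M.rowMinor j) := by
  by_cases hij : i = j
  · rw [hij]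
  obtain ⟨r, hr⟩ := Fin.exists_succAbove_eq hij
  obtain ⟨σ, hσ⟩ := Fin.exists_perm_update_succAbove hr hij
  have ui := isUnit_rowMinor hM hl hi
  have uj := isUnit_rowMinor hM hl hj
  have e : (M.rowMinor i).submatrix σ id = (M.rowMinor j).updateRow r
      (∑ k, (-(l j)⁻¹ * l (j.succAbove k)) • (M.rowMinor j) k) := by
    ext k q
    have : (M.rowMinor i).submatrix σ id k q
        = M (Function.update j.succAbove r j k) q.succ := by
      rw [hσ]; rfl
    rw [this]
    by_cases hk : k = r
    · subst hk
      have h1 := congrFun hl q.succ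
      rw [vecMul, dotProduct, Fin.sum_univ_succAbove _ j, Pi.single_eq_of_ne (Fin.succ_ne_zero q)]
        at h1
      have h2 : M j q.succ = -(l j)⁻¹ * ∑ k, l (j.succAbove k) * M (j.succAbove k) q.succ := by
        rw [← neg_eq_of_add_eq_zero_right h1, neg_mul_neg, inv_mul_cancel_left₀ hj]
      simp only [Function.update_self, updateRow_self, h2, Finset.mul_sum, Finset.sum_apply,
        Pi.smul_apply, smul_eq_mul, mul_assoc]
      rfl
    · rw [Function.update_of_ne hk, updateRow_ne hk]; rfl
  have hc : -(l j)⁻¹ * l (j.succAbove r) ≠ 0 := by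
    rw [hr]; exact mul_ne_zero (neg_ne_zero.2 (inv_ne_zero hj)) hi
  have h3 := h.map_perm hχ ui σ
  rw [e, h.map_add_sum uj r _ hc, hr, ← neg_one_mul, mul_assoc, _root_.map_mul, _root_.map_mul,
    hχ, one_mul, map_inv₀] at h3
  have hχi : χ (l i) ≠ 0 := by simpa using hi
  rw [← h3]
  field_simp

open Classical in
/-- Expansion of a row determinant along a row, modulo signs. -/
noncomputable def extend (χ : D →*₀ G) (Δ : Matrix (Fin m) (Fin m) D → G)
    (M : Matrix (Fin (m + 1)) (Fin (m + 1)) D) : G :=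
  -- Cramer's rule: an entry of the first row l of M⁻¹ is, up to sign, a minor divided by the
  -- determinant, so a single nonzero entry determines the value.
  if h : ∃ p : (Fin (m + 1) → D) × Fin (m + 1), p.1 ᵥ* M = Pi.single 0 1 ∧ p.1 p.2 ≠ 0 then
    (χ (h.choose.1 h.choose.2))⁻¹ * Δ (M.rowMinor h.choose.2)
  else 0

theorem extend_eq (h : IsRowDet χ Δ) (hχ : χ (-1) = 1)
    {M : Matrix (Fin (m + 1)) (Fin (m + 1)) D} (hM : IsUnit M) {l : Fin (m + 1) → D}
    (hl : l ᵥ* M = Pi.single 0 1) {i : Fin (m + 1)} (hi : l i ≠ 0) :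
    extend χ Δ M = (χ (l i))⁻¹ * Δ (M.rowMinor i) := by
  have hex : ∃ p : (Fin (m + 1) → D) × Fin (m + 1), p.1 ᵥ* M = Pi.single 0 1 ∧ p.1 p.2 ≠ 0 :=
    ⟨(l, i), hl, hi⟩
  rw [extend, dif_pos hex]
  have hs := hex.choose_spec
  have : hex.choose.1 = l := by
    rw [← sub_eq_zero]
    refine isUnit_iff_forall_vecMul_eq_zero.1 hM _ ?_
    rw [sub_vecMul, hs.1, hl, sub_self]
  rw [h.rowMinor_eq hχ hM hs.1 hs.2 (this ▸ hi), this]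

theorem isRowDet_extend (h : IsRowDet χ Δ) (hχ : χ (-1) = 1) : IsRowDet χ (extend χ Δ) := by
  have hex : ∀ M : Matrix (Fin (m + 1)) (Fin (m + 1)) D, IsUnit M →
      ∃ (l : Fin (m + 1) → D) (i : Fin (m + 1)), l ᵥ* M = Pi.single 0 1 ∧ l i ≠ 0 := by
    intro M hM
    obtain ⟨l, hl⟩ := exists_vecMul_eq_of_vecMul_injective
      (isUnit_iff_forall_vecMul_eq_zero.1 hM) (Pi.single 0 1)
    by_contra! hcon
    have : l = 0 := funext fun i => hcon l i hl
    rw [this, zero_vecMul] at hl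
    simpa using congrFun hl 0
  refine ⟨?_, ?_, ?_⟩
  · rw [h.extend_eq hχ isUnit_one (l := Pi.single 0 1) (i := 0) (by simp) (by simp)]
    have : (1 : Matrix (Fin (m + 1)) (Fin (m + 1)) D).rowMinor 0 = 1 := by
      ext i j; simp [rowMinor, one_apply]
    simp [this, h.map_one]
  · intro M hM i j hij c
    obtain ⟨l, k, hl, hk⟩ := hex M hM
    have hM' := isUnit_updateRow_add_smul hM hij c
    -- The operation changes l only at j, so expansion at another index, if possible, just
    -- transports it to the minor.
    have hl' : Function.update l j (l j - l i * c) ᵥ* M.updateRow i (M i + c • M j)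
        = Pi.single 0 1 := by
      rw [vecMul_updateRow_add_smul, ← hl]
      congr 1
      simp [hij]
    by_cases hkj : ∃ k, k ≠ j ∧ l k ≠ 0
    · obtain ⟨k, hkj, hk⟩ := hkj
      have hk' : Function.update l j (l j - l i * c) k = l k := by simp [hkj]
      rw [h.extend_eq hχ hM' hl' (i := k) (by rwa [hk']), h.extend_eq hχ hM hl hk, hk']
      by_cases hki : k = i
      · subst hki; rw [rowMinor_updateRow_self]
      · obtain ⟨r, rfl⟩ := Fin.exists_succAbove_eq (Ne.symm hki)
        obtain ⟨s, rfl⟩ := Fin.exists_succAbove_eq (Ne.symm hkj)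
        rw [rowMinor_updateRow_succAbove]
        congr 1
        exact h.map_add _ (isUnit_rowMinor hM hl hk) r s (fun e => hij (by rw [e])) c
    -- Now l is supported at j, so row j of M vanishes outside the first column and adding its
    -- multiples does not affect the minor.
    · push Not at hkj
      have hlj : l j ≠ 0 := by
        by_cases hh : k = j
        · rwa [← hh]
        · exact absurd (hkj k hh) hk
      have hk' : Function.update l j (l j - l i * c) j = l j := by simp [hkj i hij]
      rw [h.extend_eq hχ hM' hl' (i := j) (by rwa [hk']), h.extend_eq hχ hM hl hlj, hk']
      obtain ⟨r, rfl⟩ := Fin.exists_succAbove_eq hij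
      rw [rowMinor_updateRow_succAbove]
      congr 2
      ext a b
      have h0 : M j b.succ = 0 := by
        have := congrFun hl b.succ
        rw [vecMul, dotProduct, Finset.sum_eq_single j
          (fun k _ hk => by rw [hkj k hk, zero_mul]) (by simp),
          Pi.single_eq_of_ne (Fin.succ_ne_zero b)] at this
        exact (mul_eq_zero.1 this).resolve_left hlj
      by_cases ha : a = r
      · subst ha; simp [h0, rowMinor]
      · rw [updateRow_ne ha]
  · intro M hM i c hc
    obtain ⟨l, k, hl, hk⟩ := hex M hM
    have hM' := isUnit_updateRow_smul hM i hc
    have hl' : Function.update l i (l i * c⁻¹) ᵥ* M.updateRow i (c • M i) = Pi.single 0 1 := by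
      rw [vecMul_updateRow_smul, ← hl]
      congr 1
      simp [hc]
    have hχc : χ c ≠ 0 := by simpa using hc
    by_cases hki : k = i
    · subst hki
      rw [h.extend_eq hχ hM' hl' (i := k) (by simp [hk, hc]), h.extend_eq hχ hM hl hk,
        rowMinor_updateRow_self, Function.update_self, _root_.map_mul, map_inv₀, mul_inv, inv_inv,
        mul_comm _ (χ c), mul_assoc]
    · have hk' : Function.update l i (l i * c⁻¹) k = l k := by simp [hki]
      rw [h.extend_eq hχ hM' hl' (i := k) (by rwa [hk']), h.extend_eq hχ hM hl hk, hk']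
      obtain ⟨r, rfl⟩ := Fin.exists_succAbove_eq (Ne.symm hki)
      rw [rowMinor_updateRow_succAbove]
      have := h.map_smul _ (isUnit_rowMinor hM hl hk) r c hc
      rw [mul_left_comm, ← this]
      rfl

end IsRowDet

/-- The **Dieudonné determinant** modulo signs. -/
theorem exists_isRowDet (χ : D →*₀ G) (hχ : χ (-1) = 1) (m : ℕ) :
    ∃ Δ : Matrix (Fin m) (Fin m) D → G, IsRowDet χ Δ := by
  induction m with
  | zero =>
    exact ⟨fun _ => 1, rfl, fun _ _ i => i.elim0, fun _ _ i => i.elim0⟩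
  | succ m ih =>
    obtain ⟨Δ, h⟩ := ih
    exact ⟨_, h.isRowDet_extend hχ⟩

end RowDeterminant

/-! ### Central division algebras: square dimension and tensor products -/

section CentralDivisionAlgebra

open Module

variable {F : Type*} [Field F]

/-- Over a central division algebra, two-sided multiplication operators by a linearly independent
family on one side are independent. -/
theorem eq_zero_of_forall_sum_mul_mul_eq_zero {B ι : Type*} [DivisionRing B] [Algebra F B]
    [Algebra.IsCentral F B] {e : ι → B} (he : LinearIndependent F e) (s : Finset ι) :
    ∀ y : ι → B, (∀ z, ∑ k ∈ s, y k * z * e k = 0) → ∀ k ∈ s, y k = 0 := by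
  classical
  induction s using Finset.induction_on with
  | empty => simp
  | insert r s hr ih =>
    intro y hy
    have hyr : y r = 0 := by
      by_contra h0
      set x : ι → B := fun k => (y r)⁻¹ * y k with hx
      have hxr : x r = 1 := inv_mul_cancel₀ h0
      have hsum : ∀ z, ∑ k ∈ insert r s, x k * z * e k = 0 := fun z => by
        have := congrArg ((y r)⁻¹ * ·) (hy z)
        simpa [Finset.mul_sum, mul_assoc, hx] using this
      -- Commuting b past the relation normalised at r cancels the r-th term; the shorter relation
      -- makes every coefficient central, hence an element of F.
      have hcent : ∀ b, ∀ k ∈ s, b * x k - x k * b = 0 := by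
        intro b
        refine ih _ fun z => ?_
        have h1 := congrArg (b * ·) (hsum z)
        have h2 := hsum (b * z)
        simp only [mul_zero, Finset.mul_sum] at h1
        rw [← sub_eq_zero.2 (h1.trans h2.symm), ← Finset.sum_sub_distrib, Finset.sum_insert hr,
          hxr]
        simp only [one_mul, ← mul_assoc, sub_self, zero_add, sub_mul]
      have hF : ∀ k ∈ insert r s, ∃ c : F, algebraMap F B c = x k := by
        intro k hk
        have : x k ∈ Subalgebra.center F B := by
          rw [Subalgebra.mem_center_iff]
          intro b
          rcases Finset.mem_insert.1 hk with rfl | hk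
          · rw [hxr, mul_one, one_mul]
          · exact sub_eq_zero.1 (hcent b k hk)
        exact Algebra.mem_bot.1 (Algebra.IsCentral.out this)
      choose! c hc using hF
      have h3 : ∑ k ∈ insert r s, c k • e k = 0 := by
        rw [← hsum 1]
        refine Finset.sum_congr rfl fun k hk => ?_
        rw [mul_one, ← hc k hk, Algebra.smul_def]
      have h4 := linearIndependent_iff'.1 he _ c h3 r (Finset.mem_insert_self r s)
      have h5 := hc r (Finset.mem_insert_self r s)
      rw [h4, map_zero, hxr] at h5
      exact zero_ne_one h5
    intro k hk
    rcases Finset.mem_insert.1 hk with rfl | hk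
    · exact hyr
    · refine ih y (fun z => ?_) k hk
      have := hy z
      rwa [Finset.sum_insert hr, hyr, zero_mul, zero_mul, zero_add] at this

/-- This is B ⊗ Bᵒᵖ ≅ End_F(B): the map from coefficients to operators is injective between spaces
of equal dimension. -/
theorem exists_sum_mul_mul_eq {B ι : Type*} [DivisionRing B] [Algebra F B]
    [Algebra.IsCentral F B] [FiniteDimensional F B] [Fintype ι] (e : Basis ι F B)
    (T : B →ₗ[F] B) : ∃ y : ι → B, ∀ z, ∑ k, y k * z * e k = T z := by
  let Φ : (ι → B) →ₗ[F] (B →ₗ[F] B) :=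
    { toFun := fun y => ∑ k, LinearMap.mulRight F (e k) ∘ₗ LinearMap.mulLeft F (y k)
      map_add' := fun y y' => by ext z; simp [add_mul, Finset.sum_add_distrib]
      map_smul' := fun c y => by ext z; simp [Finset.smul_sum] }
  have happ : ∀ y z, Φ y z = ∑ k, y k * z * e k := fun y z => by simp [Φ]
  have hinj : Function.Injective Φ := (injective_iff_map_eq_zero _).2 fun y hy => by
    ext k
    refine eq_zero_of_forall_sum_mul_mul_eq_zero e.linearIndependent Finset.univ y (fun z => ?_)
      k (Finset.mem_univ k)
    rw [← happ, hy, LinearMap.zero_apply]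
  have hdim : finrank F (ι → B) = finrank F (B →ₗ[F] B) := by
    rw [finrank_pi_fintype, finrank_linearMap, Finset.sum_const, Finset.card_univ,
      finrank_eq_card_basis e, smul_eq_mul]
  obtain ⟨y, hy⟩ := (LinearMap.injective_iff_surjective_of_finrank_eq_finrank hdim).1 hinj T
  exact ⟨y, fun z => by rw [← happ, hy]⟩

/-- Two-sided multiplications by B realise a coordinate function, turning a nonzero element of an
ideal into a nonzero scalar of K. -/
theorem isSimpleRing_tensorProduct {K B : Type*} [Field K] [Algebra F K] [DivisionRing B]
    [Algebra F B] [Algebra.IsCentral F B] [FiniteDimensional F B] : IsSimpleRing (K ⊗[F] B) := by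
  let e := finBasis F B
  refine .of_eq_bot_or_eq_top fun I => ?_
  refine or_iff_not_imp_left.2 fun hI => ?_
  obtain ⟨w, hwI, hw⟩ : ∃ w ∈ I, w ≠ 0 := by
    by_contra! hcon
    exact hI (le_bot_iff.1 fun x hx => (TwoSidedIdeal.mem_bot _).2 (hcon x hx))
  let E := Algebra.TensorProduct.basis K e
  obtain ⟨j, hj⟩ : ∃ j, E.repr w j ≠ 0 := by
    by_contra! hcon
    exact hw (E.repr.map_eq_zero_iff.1 (Finsupp.ext hcon))
  obtain ⟨y, hy⟩ := exists_sum_mul_mul_eq e ((Algebra.linearMap F B) ∘ₗ e.coord j)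
  have hmem : ∑ k, ((1 : K) ⊗ₜ[F] y k) * w * ((1 : K) ⊗ₜ[F] e k) ∈ I :=
    sum_mem fun k _ => I.mul_mem_right _ _ (I.mul_mem_left _ _ hwI)
  have heq : ∑ k, ((1 : K) ⊗ₜ[F] y k) * w * ((1 : K) ⊗ₜ[F] e k) = E.repr w j ⊗ₜ[F] (1 : B) := by
    conv_lhs => rw [← E.sum_repr w]
    have h1 : ∀ i, E.repr w i • E i = E.repr w i ⊗ₜ[F] e i := fun i => by
      simp [E, TensorProduct.smul_tmul']
    simp only [h1, Finset.mul_sum, Finset.sum_mul, Algebra.TensorProduct.tmul_mul_tmul, one_mul,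
      mul_one]
    rw [Finset.sum_comm]
    simp only [← TensorProduct.tmul_sum, hy]
    rw [Finset.sum_eq_single j]
    · simp
    · intro i _ hij
      simp [hij]
    · simp
  rw [heq] at hmem
  have h1 := I.mul_mem_left ((E.repr w j)⁻¹ ⊗ₜ[F] (1 : B)) _ hmem
  rw [Algebra.TensorProduct.tmul_mul_tmul, inv_mul_cancel₀ hj, mul_one] at h1
  exact (TwoSidedIdeal.one_mem_iff I).1 h1

/-- Over an algebraic closure the algebra stays simple, hence becomes a matrix algebra of the same
dimension. -/
theorem isSquare_finrank_of_isCentral (B : Type*) [DivisionRing B] [Algebra F B]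
    [Algebra.IsCentral F B] [FiniteDimensional F B] : IsSquare (finrank F B) := by
  let K := AlgebraicClosure F
  have := isSimpleRing_tensorProduct (F := F) (K := K) (B := B)
  obtain ⟨n, _, ⟨f⟩⟩ := IsSimpleRing.exists_algEquiv_matrix_of_isAlgClosed K (K ⊗[F] B)
  refine ⟨n, ?_⟩
  have := f.toLinearEquiv.finrank_eq
  rw [finrank_baseChange, finrank_matrix] at this
  simpa using this

theorem finrank_dvd_finrank_leftIdeal {A C : Type*} [DivisionRing A] [Algebra F A] [Ring C]
    [Algebra F C] (f : A →ₐ[F] C) (I : Submodule C C) :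
    finrank F A ∣ finrank F I := by
  let _ : Module A I := Module.compHom I (f : A →+* C)
  have : IsScalarTower F A I := ⟨fun r a x => by
    change f (r • a) • x = r • (f a • x)
    rw [map_smul, smul_assoc]⟩
  exact ⟨_, (finrank_mul_finrank F A I).symm⟩

/-- A left ideal is a vector space over both A and B, so its dimension is divisible by [A : F][B :
F]; a nonzero one is everything. -/
theorem isUnit_or_eq_zero_of_coprime_finrank {A B : Type*} [DivisionRing A] [Algebra F A]
    [FiniteDimensional F A] [DivisionRing B] [Algebra F B] [FiniteDimensional F B]
    (h : Nat.Coprime (finrank F A) (finrank F B)) (x : A ⊗[F] B) : IsUnit x ∨ x = 0 := by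
  have key : ∀ x : A ⊗[F] B, x ≠ 0 → ∃ c, c * x = 1 := by
    intro x hx
    let I : Submodule (A ⊗[F] B) (A ⊗[F] B) := Ideal.span {x}
    have h1 : finrank F A * finrank F B ∣ finrank F I :=
      h.mul_dvd_of_dvd_of_dvd
        (finrank_dvd_finrank_leftIdeal Algebra.TensorProduct.includeLeft I)
        (finrank_dvd_finrank_leftIdeal Algebra.TensorProduct.includeRight I)
    have hI : I.restrictScalars F ≠ ⊥ := fun h0 => hx <| by
      have : x ∈ I.restrictScalars F := Ideal.subset_span rfl
      rwa [h0, Submodule.mem_bot] at this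
    have h2 : finrank F (I.restrictScalars F) ≠ 0 := fun h0 => hI (Submodule.finrank_eq_zero.1 h0)
    have h3 : I.restrictScalars F = ⊤ := by
      refine Submodule.eq_top_of_finrank_eq (le_antisymm (Submodule.finrank_le _) ?_)
      rw [finrank_tensorProduct]
      exact Nat.le_of_dvd (Nat.pos_of_ne_zero h2) h1
    have h4 : (1 : A ⊗[F] B) ∈ I.restrictScalars F := h3 ▸ Submodule.mem_top
    exact Ideal.mem_span_singleton'.1 h4
  refine or_iff_not_imp_right.2 fun hx => ?_
  obtain ⟨c, hc⟩ := key x hx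
  obtain ⟨d, hd⟩ := key c fun h0 => by simp [h0] at hc
  have hdx : d = x := by rw [← mul_one d, ← hc, ← mul_assoc, hd, one_mul]
  exact ⟨⟨x, c, hdx ▸ hd, hc⟩, rfl⟩

end CentralDivisionAlgebra

theorem exists_divisionRing_algEquiv_tensorProduct.{a, b, c} {F : Type c} [Field F]
    {A : Type a} {B : Type b} [DivisionRing A] [Algebra F A] [FiniteDimensional F A]
    [DivisionRing B] [Algebra F B] [FiniteDimensional F B]
    (h : Nat.Coprime (Module.finrank F A) (Module.finrank F B)) :
    ∃ (C : Type (max a b)) (_ : DivisionRing C) (_ : Algebra F C),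
      Nonempty (A ⊗[F] B ≃ₐ[F] C) :=
  ⟨A ⊗[F] B, .ofIsUnitOrEqZero (isUnit_or_eq_zero_of_coprime_finrank h),
    Algebra.TensorProduct.instAlgebra, ⟨AlgEquiv.refl⟩⟩

theorem schurIndex_eq_algDegree (F A : Type*) [Field F] [DivisionRing A] [Algebra F A] :
    schurIndex F A = algDegree F A := by
  have : {n : ℕ | ∃ (m : ℕ) (D : Type _) (_ : DivisionRing D) (_ : Algebra F D),
      0 < m ∧ Nonempty (A ≃ₐ[F] Matrix (Fin m) (Fin m) D) ∧ algDegree F D = n}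
      = {algDegree F A} := by
    ext n
    constructor
    · rintro ⟨m, D, _, _, hm, ⟨f⟩, rfl⟩
      have h1 : m = 1 := by
        by_contra hne
        -- An off-diagonal matrix unit would be a nonzero element of square zero.
        have h2 : 1 < m := by omega
        let i : Fin m := ⟨0, hm⟩
        let j : Fin m := ⟨1, h2⟩
        have hij : j ≠ i := fun h => by simpa [i, j] using congrArg Fin.val h
        have h3 : f.symm (Matrix.single i j 1) = 0 := by
          rw [← mul_self_eq_zero, ← map_mul, Matrix.single_mul_single_of_ne _ _ _ _ hij, map_zero]
        have h4 : (Matrix.single i j 1 : Matrix (Fin m) (Fin m) D) = 0 :=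
          (EmbeddingLike.map_eq_zero_iff (f := f.symm)).1 h3
        simpa using congrFun (congrFun h4 i) j
      subst h1
      simp only [Set.mem_singleton_iff, algDegree]
      rw [f.toLinearEquiv.finrank_eq, Module.finrank_matrix]
      simp
    · rintro rfl
      refine ⟨1, A, inferInstance, inferInstance, one_pos, ⟨.ofBijective (Matrix.scalarAlgHom (Fin 1) F)
        ⟨fun x y h => by simpa using congrFun (congrFun h 0) 0, fun M => ⟨M 0 0, ?_⟩⟩⟩, rfl⟩
      ext i j
      simp [Fin.fin_one_eq_zero i, Fin.fin_one_eq_zero j]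
  rw [schurIndex, this, csInf_singleton]

theorem coprime_finrank_of_coprime_schurIndex {F A B : Type*} [Field F]
    [DivisionRing A] [Algebra F A] [Algebra.IsCentral F A] [FiniteDimensional F A]
    [DivisionRing B] [Algebra F B] [Algebra.IsCentral F B] [FiniteDimensional F B]
    (h : Nat.Coprime (schurIndex F A) (schurIndex F B)) :
    Nat.Coprime (Module.finrank F A) (Module.finrank F B) := by
  obtain ⟨a, ha⟩ := isSquare_finrank_of_isCentral (F := F) A
  obtain ⟨b, hb⟩ := isSquare_finrank_of_isCentral (F := F) B
  rw [schurIndex_eq_algDegree, schurIndex_eq_algDegree, algDegree, algDegree, ha, hb,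
    Nat.sqrt_eq, Nat.sqrt_eq] at h
  rw [ha, hb]
  exact (h.mul_right h).mul_left (h.mul_right h)

/-! ### The regular representation with entries in A -/

section RegularRepresentation

open Module Matrix

variable {F : Type*} [Field F] {A B C ι : Type*} [Fintype ι] [DecidableEq ι]

/-- The multiplication table of a basis of a central division algebra is an invertible matrix. -/
theorem isUnit_mulTable [DivisionRing B] [Algebra F B] [Algebra.IsCentral F B] (e : Basis ι F B) :
    IsUnit (of fun k j => e j * e k : Matrix ι ι B) := by
  rw [isUnit_iff_forall_vecMul_eq_zero]
  intro w hw
  have h : ∀ z, ∑ k, w k * z * e k = 0 := by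
    intro z
    have h1 : ∀ j, ∑ k, w k * e j * e k = 0 := fun j => by
      simpa [vecMul, dotProduct, mul_assoc] using congrFun hw j
    rw [← e.sum_repr z]
    simp only [Finset.mul_sum, Finset.sum_mul]
    rw [Finset.sum_comm]
    refine Finset.sum_eq_zero fun j _ => ?_
    simp only [mul_smul_comm, smul_mul_assoc, ← Finset.smul_sum, h1, smul_zero]
  ext k
  exact eq_zero_of_forall_sum_mul_mul_eq_zero e.linearIndependent Finset.univ w h k
    (Finset.mem_univ k)

/-- The multiplication table intertwines scalar matrices and the regular representation. -/
theorem sum_leftMulMatrix_smul_mul [Ring B] [Algebra F B] (e : Basis ι F B) (b : B) (k j : ι) :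
    ∑ i, Algebra.leftMulMatrix e b i j • (e i * e k) = b * (e j * e k) := by
  simp only [← smul_mul_assoc, ← Finset.sum_mul, Algebra.leftMulMatrix_eq_repr_mul, e.sum_repr,
    mul_assoc]

theorem commute_scalarAlgHom_leftMulMatrix [Ring A] [Algebra F A] [Ring B] [Algebra F B]
    (e : Basis ι F B) (a : A) (b : B) : Commute (scalarAlgHom ι F a)
      ((Algebra.ofId F A).mapMatrix.comp (Algebra.leftMulMatrix e) b) := by
  ext i j
  simp [Algebra.ofId_apply, Algebra.commutes]

/-- The regular representation of `B` extended to `A ⊗ B ≃ C`, with matrix entries in `A`. -/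
noncomputable def regularRep [Ring A] [Algebra F A] [Ring B] [Algebra F B] [Ring C] [Algebra F C]
    (f : A ⊗[F] B ≃ₐ[F] C) (e : Basis ι F B) : C →ₐ[F] Matrix ι ι A :=
  (Algebra.TensorProduct.lift (scalarAlgHom ι F)
    ((Algebra.ofId F A).mapMatrix.comp (Algebra.leftMulMatrix e))
    (commute_scalarAlgHom_leftMulMatrix e)).comp (f.symm : C →ₐ[F] A ⊗[F] B)

variable [Ring A] [Algebra F A] [Ring B] [Algebra F B] [Ring C] [Algebra F C]
  (f : A ⊗[F] B ≃ₐ[F] C) (e : Basis ι F B)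

theorem regularRep_tmul (a : A) (b : B) (i j : ι) :
    regularRep f e (f (a ⊗ₜ b)) i j = a * algebraMap F A (Algebra.leftMulMatrix e b i j) := by
  have : regularRep f e (f (a ⊗ₜ b)) = scalarAlgHom ι F a *
      (Algebra.ofId F A).mapMatrix (Algebra.leftMulMatrix e b) := by
    rw [regularRep]
    exact (congrArg _ (f.symm_apply_apply _)).trans (Algebra.TensorProduct.lift_tmul _ _
      (commute_scalarAlgHom_leftMulMatrix e) a b)
  rw [this]
  simp [Algebra.ofId_apply]

theorem mul_eq_sum_mul_regularRep (c : C) (j k : ι) :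
    c * f (1 ⊗ₜ (e j * e k)) =
      ∑ i, f (1 ⊗ₜ (e i * e k)) * f (regularRep f e c i j ⊗ₜ 1) := by
  obtain ⟨t, rfl⟩ := f.surjective c
  induction t using TensorProduct.induction_on with
  | zero => simp
  | tmul a b =>
    simp only [regularRep_tmul, ← map_mul, ← map_sum, Algebra.TensorProduct.tmul_mul_tmul, one_mul,
      mul_one]
    congr 1
    rw [← sum_leftMulMatrix_smul_mul, TensorProduct.tmul_sum]
    refine Finset.sum_congr rfl fun i _ => ?_
    rw [TensorProduct.tmul_smul, TensorProduct.smul_tmul', ← Algebra.commutes, Algebra.smul_def]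
  | add x y hx hy =>
    rw [map_add, add_mul, hx, hy, ← Finset.sum_add_distrib]
    refine Finset.sum_congr rfl fun i _ => ?_
    rw [← mul_add, map_add, Matrix.add_apply, TensorProduct.add_tmul, map_add]

/-- Once the multiplication table is invertible, this conjugates ρ(c), viewed over C, to the scalar
matrix c. -/
theorem scalar_mul_mulTable (c : C) :
    scalar ι c * (of fun k j => f (1 ⊗ₜ (e j * e k)) : Matrix ι ι C) =
      (of fun k j => f (1 ⊗ₜ (e j * e k))) * (regularRep f e c).map fun a => f (a ⊗ₜ 1) := by
  ext k j
  rw [scalar_apply, diagonal_mul, Matrix.mul_apply]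
  exact mul_eq_sum_mul_regularRep f e c j k

end RegularRepresentation

/-! ### The functor CK -/

section CK

open scoped commutatorElement

variable (F : Type*) [Field F]

instance CK.commGroup (A : Type*) [Ring A] [Algebra F A] : CommGroup (CK F A) :=
  { (inferInstance : Group (CK F A)) with
    mul_comm := fun x y => by
      obtain ⟨a, rfl⟩ := QuotientGroup.mk_surjective x
      obtain ⟨b, rfl⟩ := QuotientGroup.mk_surjective y
      rw [← QuotientGroup.mk_mul, ← QuotientGroup.mk_mul, QuotientGroup.eq]
      have h : ⁅b⁻¹, a⁻¹⁆ ∈ commutator Aˣ :=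
        Subgroup.commutator_mem_commutator (Subgroup.mem_top _) (Subgroup.mem_top _)
      have h' := (le_sup_right : commutator Aˣ ≤ ckSubgroup F A) h
      rw [commutatorElement_def, inv_inv, inv_inv] at h'
      rwa [mul_inv_rev, ← mul_assoc] }

variable {F}

theorem CK.mk_algebraMap {A : Type*} [Ring A] [Algebra F A] (x : Fˣ) :
    ((Units.map (algebraMap F A : F →* A) x : Aˣ) : CK F A) = 1 :=
  (QuotientGroup.eq_one_iff _).2 ((le_sup_left : _ ≤ ckSubgroup F A) ⟨x, rfl⟩)

/-- A homomorphism to a commutative group which is trivial on `F^*` factors through `CK`. -/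
def CK.lift {A G : Type*} [Ring A] [Algebra F A] [CommGroup G] (φ : Aˣ →* G)
    (h : ∀ x : Fˣ, φ (Units.map (algebraMap F A : F →* A) x) = 1) : CK F A →* G :=
  QuotientGroup.lift _ φ <| by
    rw [ckSubgroup, sup_le_iff]
    refine ⟨?_, Abelianization.commutator_subset_ker φ⟩
    rintro _ ⟨x, rfl⟩
    exact h x

@[simp]
theorem CK.lift_mk {A G : Type*} [Ring A] [Algebra F A] [CommGroup G] (φ : Aˣ →* G)
    (h : ∀ x : Fˣ, φ (Units.map (algebraMap F A : F →* A) x) = 1) (a : Aˣ) :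
    CK.lift φ h (a : CK F A) = φ a := rfl

/-- Functoriality of `CK`. -/
def CK.map {A C : Type*} [Ring A] [Algebra F A] [Ring C] [Algebra F C] (f : A →ₐ[F] C) :
    CK F A →* CK F C :=
  CK.lift ((QuotientGroup.mk' _).comp (Units.map (f : A →* C))) fun x => by
    rw [MonoidHom.comp_apply, QuotientGroup.mk'_apply]
    convert CK.mk_algebraMap (F := F) (A := C) x using 2
    ext
    simp

@[simp]
theorem CK.map_mk {A C : Type*} [Ring A] [Algebra F A] [Ring C] [Algebra F C] (f : A →ₐ[F] C)
    (a : Aˣ) : CK.map f (a : CK F A) = (Units.map (f : A →* C) a : Cˣ) := rfl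

/-- `CK` of isomorphic algebras. -/
def CK.congr {A C : Type*} [Ring A] [Algebra F A] [Ring C] [Algebra F C] (f : A ≃ₐ[F] C) :
    CK F A ≃* CK F C :=
  MonoidHom.toMulEquiv (CK.map (f : A →ₐ[F] C)) (CK.map (f.symm : C →ₐ[F] A))
    (by
      ext x
      simp only [MonoidHom.comp_apply, QuotientGroup.mk'_apply, CK.map_mk, MonoidHom.id_apply]
      congr 1
      ext
      simp)
    (by
      ext x
      simp only [MonoidHom.comp_apply, QuotientGroup.mk'_apply, CK.map_mk, MonoidHom.id_apply]
      congr 1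
      ext
      simp)

open Classical in
/-- The projection of a division algebra onto `CK`, with `0` adjoined. -/
noncomputable def CK.proj (F D : Type*) [Field F] [DivisionRing D] [Algebra F D] :
    D →*₀ WithZero (CK F D) :=
  (WithZero.map' (QuotientGroup.mk' (ckSubgroup F D))).comp
    (MonoidWithZeroHom.ofClass (WithZero.withZeroUnitsEquiv (G := D)).symm)

theorem CK.proj_unit {D : Type*} [DivisionRing D] [Algebra F D] (u : Dˣ) :
    CK.proj F D u = ((u : CK F D) : WithZero (CK F D)) := by
  classical
  simp [CK.proj, WithZero.withZeroUnitsEquiv]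

end CK

/-! ### The transfer on CK -/

section Transfer

open Module Matrix

variable {F : Type*} [Field F]

/-- The group homomorphism on invertible matrices given by a row determinant. -/
noncomputable def IsRowDet.unitsHom {D G n : Type*} [DivisionRing D] [CommGroup G] [Fintype n]
    [DecidableEq n] {χ : D →*₀ WithZero G} {Δ : Matrix n n D → WithZero G} (h : IsRowDet χ Δ) :
    (Matrix n n D)ˣ →* G :=
  (WithZero.unitsWithZeroEquiv (α := G)).toMonoidHom.comp <| MonoidHom.toHomUnits
    { toFun := fun u => Δ u
      map_one' := h.map_one
      map_mul' := fun u v => h.map_mul u.isUnit v.isUnit }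

theorem IsRowDet.coe_unitsHom {D G n : Type*} [DivisionRing D] [CommGroup G] [Fintype n]
    [DecidableEq n] {χ : D →*₀ WithZero G} {Δ : Matrix n n D → WithZero G} (h : IsRowDet χ Δ)
    (u : (Matrix n n D)ˣ) : (h.unitsHom u : WithZero G) = Δ u := by
  simp [unitsHom, WithZero.unitsWithZeroEquiv]

theorem CK.proj_algebraMap {D : Type*} [DivisionRing D] [Algebra F D] {x : F} (hx : x ≠ 0) :
    CK.proj F D (algebraMap F D x) = 1 := by
  have := CK.proj_unit (F := F) (Units.map (algebraMap F D : F →* D) (Units.mk0 x hx))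
  rw [CK.mk_algebraMap] at this
  simpa using this

theorem exists_isRowDet_proj (F D : Type*) [Field F] [DivisionRing D] [Algebra F D] (m : ℕ) :
    ∃ Δ : Matrix (Fin m) (Fin m) D → WithZero (CK F D), IsRowDet (CK.proj F D) Δ := by
  refine exists_isRowDet _ ?_ m
  have := CK.proj_algebraMap (F := F) (D := D) (x := -1) (by simp)
  simpa using this

theorem CK.map'_comp_proj {A C : Type*} [DivisionRing A] [Algebra F A] [DivisionRing C]
    [Algebra F C] (f : A →ₐ[F] C) :
    (WithZero.map' (CK.map f)).comp (CK.proj F A)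
      = (CK.proj F C).comp (RingHom.toMonoidWithZeroHom (f : A →+* C)) := by
  ext a
  by_cases ha : a = 0
  · simp [ha]
  · have h1 := CK.proj_unit (F := F) (Units.mk0 a ha)
    have h2 := CK.proj_unit (F := F) (Units.map (f : A →* C) (Units.mk0 a ha))
    rw [Units.val_mk0] at h1
    rw [MonoidWithZeroHom.comp_apply, h1, WithZero.map'_coe, CK.map_mk, ← h2]
    rfl

/-- On matrices over F the constant 1 is also a row determinant for the restricted character, so
uniqueness applies. -/
theorem IsRowDet.map_algebraMap {D n : Type*} [DivisionRing D] [Algebra F D] [Fintype n]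
    [DecidableEq n] {Δ : Matrix n n D → WithZero (CK F D)} (h : IsRowDet (CK.proj F D) Δ)
    {N : Matrix n n F} (hN : IsUnit N) : Δ (N.map (algebraMap F D)) = 1 :=
  (h.comp_map (algebraMap F D)).eq_of_isUnit (Δ' := fun _ => 1)
    ⟨rfl, fun _ _ _ _ _ _ => rfl, fun _ _ _ c hc => by
      rw [mul_one]; exact (CK.proj_algebraMap hc).symm⟩ hN

theorem IsRowDet.map_diagonal_unit {D n : Type*} [DivisionRing D] [Algebra F D] [Fintype n]
    [DecidableEq n] {Δ : Matrix n n D → WithZero (CK F D)} (h : IsRowDet (CK.proj F D) Δ)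
    (d : Dˣ) : Δ (diagonal fun _ => (d : D)) = (((d : CK F D) ^ Fintype.card n : CK F D)) := by
  rw [h.map_diagonal _ fun _ => d.ne_zero]
  simp [CK.proj_unit]

/-- Both sides are row determinants over A for the same character. -/
theorem IsRowDet.map_algHom {A C n : Type*} [DivisionRing A] [Algebra F A] [DivisionRing C]
    [Algebra F C] [Fintype n] [DecidableEq n] {Δ : Matrix n n A → WithZero (CK F A)}
    {Δ' : Matrix n n C → WithZero (CK F C)} (h : IsRowDet (CK.proj F A) Δ)
    (h' : IsRowDet (CK.proj F C) Δ') (f : A →ₐ[F] C) {M : Matrix n n A} (hM : IsUnit M) :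
    Δ' (M.map f) = WithZero.map' (CK.map f) (Δ M) := by
  have h1 := h.map_comp (WithZero.map' (CK.map f))
  rw [CK.map'_comp_proj] at h1
  exact (h'.comp_map (f : A →+* C)).eq_of_isUnit h1 hM

variable {A B C : Type*} [DivisionRing A] [Algebra F A] [DivisionRing B] [Algebra F B]
  [DivisionRing C] [Algebra F C]

/-- The first factor of a tensor product decomposition. -/
def tensorInl (f : A ⊗[F] B ≃ₐ[F] C) : A →ₐ[F] C :=
  (f : A ⊗[F] B →ₐ[F] C).comp Algebra.TensorProduct.includeLeft

/-- The second factor of a tensor product decomposition. -/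
def tensorInr (f : A ⊗[F] B ≃ₐ[F] C) : B →ₐ[F] C :=
  (f : A ⊗[F] B →ₐ[F] C).comp Algebra.TensorProduct.includeRight

theorem exists_ck_transfer [Algebra.IsCentral F B] [FiniteDimensional F B]
    (f : A ⊗[F] B ≃ₐ[F] C) :
    ∃ Φ : CK F C →* CK F A,
      (∀ a, Φ (CK.map (tensorInl f) a) = a ^ finrank F B) ∧
      (∀ b, Φ (CK.map (tensorInr f) b) = 1) ∧
      ∀ c, CK.map (tensorInl f) (Φ c) = c ^ finrank F B := by
  let e := finBasis F B
  obtain ⟨Δ, hΔ⟩ := exists_isRowDet_proj F A (finrank F B)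
  obtain ⟨Δ', hΔ'⟩ := exists_isRowDet_proj F C (finrank F B)
  let φ : Cˣ →* CK F A := hΔ.unitsHom.comp (Units.map (regularRep f e : C →* _))
  have hφ : ∀ c : Cˣ, (φ c : WithZero (CK F A)) = Δ (regularRep f e c) := fun c =>
    hΔ.coe_unitsHom _
  have hφr : ∀ b : Bˣ, φ (Units.map (tensorInr f : B →* C) b) = 1 := by
    intro b
    rw [← WithZero.coe_inj, hφ, WithZero.coe_one]
    have : regularRep f e (Units.map (tensorInr f : B →* C) b : C)
        = (Algebra.leftMulMatrix e b).map (algebraMap F A) := by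
      ext i j
      exact (regularRep_tmul f e 1 (b : B) i j).trans (one_mul _)
    rw [this]
    exact hΔ.map_algebraMap (b.isUnit.map (Algebra.leftMulMatrix e))
  have hφF : ∀ x : Fˣ, φ (Units.map (algebraMap F C : F →* C) x) = 1 := by
    intro x
    rw [← hφr (Units.map (algebraMap F B : F →* B) x)]
    congr 1
    ext
    exact ((tensorInr f).commutes (x : F)).symm
  refine ⟨CK.lift φ hφF, ?_, ?_, ?_⟩
  · intro x
    obtain ⟨a, rfl⟩ := QuotientGroup.mk_surjective x
    rw [CK.map_mk, CK.lift_mk, ← WithZero.coe_inj, hφ]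
    have hd := hΔ.map_diagonal_unit a
    rw [Fintype.card_fin] at hd
    rw [← hd]
    congr 1
    ext i j
    refine (regularRep_tmul f e (a : A) 1 i j).trans ?_
    rw [map_one, diagonal_apply, one_apply]
    split_ifs <;> simp
  · intro x
    obtain ⟨b, rfl⟩ := QuotientGroup.mk_surjective x
    exact hφr b
  · intro x
    obtain ⟨c, rfl⟩ := QuotientGroup.mk_surjective x
    rw [CK.lift_mk, ← WithZero.coe_inj, ← WithZero.map'_coe, hφ]
    have hd := hΔ'.map_diagonal_unit c
    rw [Fintype.card_fin] at hd
    rw [← hd]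
    have hu : IsUnit (regularRep f e c) := c.isUnit.map (regularRep f e)
    rw [← hΔ.map_algHom hΔ' (tensorInl f) hu]
    have hU : IsUnit (of fun k j => f (1 ⊗ₜ (e j * e k)) :
        Matrix (Fin (finrank F B)) (Fin (finrank F B)) C) :=
      (isUnit_mulTable e).map ((tensorInr f).mapMatrix (m := Fin (finrank F B)))
    have h1 := congrArg Δ' (scalar_mul_mulTable f e (c : C))
    have hs : IsUnit (scalar (Fin (finrank F B)) (c : C)) := c.isUnit.map _
    have hV : IsUnit ((regularRep f e c).map (tensorInl f)) := hu.map (tensorInl f).mapMatrix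
    -- Determinants take commutative values, so the multiplication table cancels from the
    -- intertwining identity.
    rw [hΔ'.map_mul hs hU, mul_comm] at h1
    replace h1 := h1.trans (hΔ'.map_mul hU hV)
    exact (mul_left_cancel₀ (hΔ'.ne_zero hU) h1).symm

/-- Apply the transfer with A = F: the n-th power factors through CK(F), which is trivial. -/
theorem ck_pow_finrank_eq_one [Algebra.IsCentral F B] [FiniteDimensional F B] (b : CK F B) :
    b ^ finrank F B = 1 := by
  obtain ⟨Φ, -, -, h⟩ := exists_ck_transfer (Algebra.TensorProduct.lid F B)
  obtain ⟨x, hx⟩ := QuotientGroup.mk_surjective (Φ b)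
  have h1 : Φ b = 1 := by
    rw [← hx]
    exact CK.mk_algebraMap (A := F) x
  rw [← h b, h1, map_one]

end Transfer

/-! ### Assembling the isomorphism -/

section Main

open Module

theorem ck_mulEquiv_prod_of_coprime_finrank {F A B C : Type*} [Field F]
    [DivisionRing A] [Algebra F A] [Algebra.IsCentral F A] [FiniteDimensional F A]
    [DivisionRing B] [Algebra F B] [Algebra.IsCentral F B] [FiniteDimensional F B]
    [DivisionRing C] [Algebra F C] (f : A ⊗[F] B ≃ₐ[F] C)
    (hcop : Nat.Coprime (finrank F A) (finrank F B)) :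
    Nonempty (CK F C ≃* CK F A × CK F B) := by
  obtain ⟨Φ, hΦl, hΦr, hΦ⟩ := exists_ck_transfer f
  obtain ⟨Ψ, hΨr, hΨl, hΨ⟩ := exists_ck_transfer ((Algebra.TensorProduct.comm F B A).trans f)
  have hl : tensorInr ((Algebra.TensorProduct.comm F B A).trans f) = tensorInl f := by
    ext; simp [tensorInl, tensorInr]
  have hr : tensorInl ((Algebra.TensorProduct.comm F B A).trans f) = tensorInr f := by
    ext; simp [tensorInl, tensorInr]
  rw [hl] at hΨl
  rw [hr] at hΨr hΨ
  let θ : CK F A × CK F B →* CK F C := (CK.map (tensorInl f)).coprod (CK.map (tensorInr f))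
  refine ⟨(MulEquiv.ofBijective θ ⟨?_, ?_⟩).symm⟩
  · rw [injective_iff_map_eq_one]
    rintro ⟨a, b⟩ h
    have h0 : CK.map (tensorInl f) a * CK.map (tensorInr f) b = 1 := h
    -- Each transfer kills the other factor, so a is killed by [B : F] here and by [A : F] as an
    -- element of CK(A); likewise for b with the roles exchanged.
    have ha : a ^ finrank F B = 1 := by simpa [hΦl, hΦr] using congrArg Φ h0
    have hb : b ^ finrank F A = 1 := by simpa [hΨl, hΨr] using congrArg Ψ h0
    have ha' := pow_gcd_eq_one.2 ⟨ck_pow_finrank_eq_one a, ha⟩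
    have hb' := pow_gcd_eq_one.2 ⟨hb, ck_pow_finrank_eq_one b⟩
    rw [hcop.gcd_eq_one, pow_one] at ha' hb'
    rw [ha', hb']
    rfl
  · intro c
    have hbez := Nat.gcd_eq_gcd_ab (finrank F A) (finrank F B)
    rw [hcop.gcd_eq_one] at hbez
    set s := (finrank F A).gcdA (finrank F B)
    set t := (finrank F A).gcdB (finrank F B)
    -- With s[A : F] + t[B : F] = 1, the two transfers return to CK(C) as c^(t[B : F]) and c^(s[A :
    -- F]), whose product is c.
    refine ⟨(Φ c ^ t, Ψ c ^ s), ?_⟩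
    change CK.map (tensorInl f) (Φ c ^ t) * CK.map (tensorInr f) (Ψ c ^ s) = c
    rw [map_zpow, map_zpow, hΦ, hΨ, ← zpow_natCast, ← zpow_natCast, ← zpow_mul, ← zpow_mul,
      ← zpow_add, add_comm, ← hbez, Nat.cast_one, zpow_one]

end Main

theorem mainTheorem9 {F : Type*} {A : Type*} {B : Type*} [Field F]
    [DivisionRing A] [Algebra F A] [Algebra.IsCentral F A] [FiniteDimensional F A]
    [DivisionRing B] [Algebra F B] [Algebra.IsCentral F B] [FiniteDimensional F B]
    (hcop : Nat.Coprime (schurIndex F A) (schurIndex F B)) :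
    Nonempty (CK F (A ⊗[F] B) ≃* CK F A × CK F B) := by
  have h := coprime_finrank_of_coprime_schurIndex hcop
  obtain ⟨C, _, _, ⟨f⟩⟩ := exists_divisionRing_algEquiv_tensorProduct h
  obtain ⟨g⟩ := ck_mulEquiv_prod_of_coprime_finrank f h
  exact ⟨(CK.congr f).trans g⟩
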